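/- Write $\operatorname{sech} t = 1/\cosh t$. Let $n \ge 0$ be an integer and let $x$ be a complex (in particular, possibly real) number, with the convention $0^0 = 1$. (a) Let $L_B$ be a real random variable with the logistic distribution, that is, with density $\frac{\pi}{2}\operatorname{sech}^2(\pi t)$, $t \in \mathbb{R}$, and let $U_B$ be a random variable uniformly distributed over $[0,1]$ and independent of $L_B$. Then $\left(x + iL_B - \tfrac12 + U_B\right)^n$ is integrable and $$\mathbb{E}\left(x + iL_B - \tfrac12 + U_B\right)^n = x^n .$$ (b) Let $L_E$ be a real random variable with the hyperbolic secant distribution, that is, with density $\operatorname{sech}(\pi t)$, $t \in \mathbb{R}$, and let $U_E$ be a random variable independent of $L_E$ with $\Pr\{U_E = 0\} = \Pr\{U_E = 1\} = \tfrac12$. Then $\left(x + iL_E - \tfrac12 + U_E\right)^n$ is integrable and $$\mathbb{E}\left(x + iL_E - \tfrac12 + U_E\right)^n = x^n .$$ -/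

import Mathlib

open MeasureTheory ProbabilityTheory

noncomputable section

/-- The hyperbolic secant. -/
def sech (x : ℝ) : ℝ := 1 / Real.cosh x

/-- The density `(π / 2) sech² (π x)` of the logistic distribution. -/
def logisticDensity (x : ℝ) : ℝ := Real.pi / 2 * sech (Real.pi * x) ^ 2

/-- The density `sech (π x)` of the hyperbolic secant distribution. -/
def sechDensity (x : ℝ) : ℝ := sech (Real.pi * x)

/-- The logistic distribution on `ℝ`. -/
def logisticLaw : Measure ℝ :=
  (volume : Measure ℝ).withDensity fun x => ENNReal.ofReal (logisticDensity x)

/-- The hyperbolic secant distribution on `ℝ`. -/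
def sechLaw : Measure ℝ :=
  (volume : Measure ℝ).withDensity fun x => ENNReal.ofReal (sechDensity x)

open Filter Topology in
theorem prob_of_antideriv (f F : ℝ → ℝ) (hF : ∀ x, HasDerivAt F (f x) x) (h0 : ∀ x, 0 ≤ f x)
   (hb : Tendsto F atBot (𝓝 0)) (ht : Tendsto F atTop (𝓝 1)) :
   IsProbabilityMeasure ((volume : Measure ℝ).withDensity fun x => ENNReal.ofReal (f x)) := by
  have h1 : IntegrableOn f (Set.Ioi 0) :=
    integrableOn_Ioi_deriv_of_nonneg' (fun x _ => hF x) (fun x _ => h0 x) ht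
  have h2 : IntegrableOn (fun x => f (-x)) (Set.Ioi 0) := by
    refine integrableOn_Ioi_deriv_of_nonneg' (g := fun x => - F (-x)) (l := -0) (fun x _ => ?_) (fun x _ => h0 _) (hb.comp tendsto_neg_atTop_atBot).neg
    have := ((hF (-x)).scomp x (hasDerivAt_neg x)).neg
    convert! this using 1
    simp
  have h3 : IntegrableOn f (Set.Iic 0) := by
    rw [integrableOn_Iic_iff_integrableOn_Iio]
    have h5 := IntegrableOn.comp_neg_Iio (c := (0 : ℝ)) (f := fun x => f (-x)) (by rwa [neg_zero])
    simpa only [neg_neg] using h5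
  have h4 : Integrable f := by
    rw [← integrableOn_univ, ← Set.Iic_union_Ioi (a := (0:ℝ))]
    exact h3.union h1
  constructor
  rw [withDensity_apply _ MeasurableSet.univ, Measure.restrict_univ,
    ← ofReal_integral_eq_lintegral_ofReal h4 (.of_forall h0),
    integral_of_hasDerivAt_of_tendsto hF h4 hb ht]
  simp

open Filter Topology in
instance sechLaw_isProbabilityMeasure : IsProbabilityMeasure sechLaw := by
  refine prob_of_antideriv _ (fun x => 2 / Real.pi * Real.arctan (Real.exp (Real.pi * x))) (fun x => ?_) (fun x => ?_) ?_ ?_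
  · have := (((hasDerivAt_id x).const_mul Real.pi).exp.arctan).const_mul (2 / Real.pi)
    convert! this using 1
    have hp := Real.pi_pos
    simp only [sechDensity, sech, Real.cosh_eq, Real.exp_neg, id]
    have := Real.exp_pos (Real.pi * x)
    field_simp
    ring
  · unfold sechDensity sech; positivity
  · have h : Tendsto (fun x:ℝ => Real.pi * x) atBot atBot := tendsto_id.const_mul_atBot Real.pi_pos
    have := ((Real.continuous_arctan.tendsto 0).comp (Real.tendsto_exp_atBot.comp h)).const_mul (2/Real.pi)
    simpa using this
  · have h : Tendsto (fun x:ℝ => Real.pi * x) atTop atTop := tendsto_id.const_mul_atTop Real.pi_pos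
    have := ((Real.tendsto_arctan_atTop.mono_right nhdsWithin_le_nhds).comp (Real.tendsto_exp_atTop.comp h)).const_mul (2/Real.pi)
    rwa [show 2 / Real.pi * (Real.pi / 2) = 1 by field_simp] at this

open Filter Topology in
instance logisticLaw_isProbabilityMeasure : IsProbabilityMeasure logisticLaw := by
  refine prob_of_antideriv _ (fun x => 1 - (1 + Real.exp (2 * Real.pi * x))⁻¹) (fun x => ?_) (fun x => ?_) ?_ ?_
  · have h := (((hasDerivAt_id x).const_mul (2*Real.pi)).exp.const_add 1)
    have := (h.inv (by simp only [id]; positivity)).const_sub 1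
    convert! this using 1
    simp only [logisticDensity, sech, Real.cosh_eq, Real.exp_neg, id]
    have h2 : Real.exp (2 * Real.pi * x) = Real.exp (Real.pi * x) ^ 2 := by
      rw [← Real.exp_nat_mul]; ring_nf
    rw [h2]
    have := Real.exp_pos (Real.pi * x)
    field_simp
    ring
  · unfold logisticDensity sech; positivity
  · have h : Tendsto (fun x:ℝ => 2*Real.pi * x) atBot atBot := tendsto_id.const_mul_atBot (by positivity)
    have := (((Real.tendsto_exp_atBot.comp h).const_add 1).inv₀ (by norm_num)).const_sub 1
    simpa using this
  · have h : Tendsto (fun x:ℝ => 2*Real.pi * x) atTop atTop := tendsto_id.const_mul_atTop (by positivity)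
    have := ((tendsto_inv_atTop_zero.comp (tendsto_atTop_add_const_left _ 1 (Real.tendsto_exp_atTop.comp h)))).const_sub 1
    simpa using this

end

/-! Averaging over `U` first turns each claim into one about a polynomial `p` on the lines Im z =
±1/2: with `p = (x + iX)^(n+1)` the uniform variable gives (p(t - i/2) - p(t + i/2)) / (n+1), and
with `p = (x + iX)^n` the coin gives half of p(t - i/2) + p(t + i/2).

The function z / sinh(πz) is holomorphic for |Im z| < 1, and 1 / sinh(πz) equals ∓i sech(πt) at z =
t ± i/2. Moving the contour between the two lines (`integral_horizontal_line_eq`,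
`integral_eval_mul_sech_pow`) shows that the sum integrates to 0 against sech when X divides `p`,
and the difference integrates to 0 against sech² when X² divides `p`. The factor X^m cancels the
pole at 0. The remaining Taylor terms at 0 are evaluated using only total mass 1; they give 2p(0)
and -i p'(0), hence x^n in both cases. -/

theorem integrable_exp_neg_abs : Integrable fun t : ℝ => Real.exp (-|t|) := by
  refine (integrable_inv_one_add_sq.const_mul 2).mono' (by fun_prop) (.of_forall fun t => ?_)
  have h := Real.quadratic_le_exp_of_nonneg (abs_nonneg t)
  have hs := sq_abs t
  have := abs_nonneg t
  rw [Real.norm_eq_abs, abs_of_pos (Real.exp_pos _), Real.exp_neg, ← div_eq_mul_inv,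
    inv_eq_one_div, div_le_div_iff₀ (Real.exp_pos _) (by positivity)]
  nlinarith

open Filter Topology Complex in
/-- Contour shift in a horizontal strip for a holomorphic function of exponential decay. -/
theorem integral_horizontal_line_eq {f : ℂ → ℂ} {a b C : ℝ} (hab : a ≤ b)
    (hd : DifferentiableOn ℂ f {z | z.im ∈ Set.Icc a b})
    (hC : ∀ z : ℂ, z.im ∈ Set.Icc a b → ‖f z‖ ≤ C * Real.exp (-|z.re|)) :
    ∫ t : ℝ, f (t + a * I) = ∫ t : ℝ, f (t + b * I) := by
  have hI : ∀ c ∈ Set.Icc a b, Integrable fun t : ℝ => f (t + c * I) := by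
    intro c hc
    have hcont : Continuous fun t : ℝ => f (t + c * I) :=
      hd.continuousOn.comp_continuous (by fun_prop) (fun t => by simpa using hc)
    refine (integrable_exp_neg_abs.const_mul C).mono' hcont.aestronglyMeasurable (.of_forall fun t => ?_)
    simpa using hC (t + c * I) (by simpa using hc)
  have hexp : Tendsto (fun T : ℝ => C * Real.exp (-|T|) * |b - a|) atTop (𝓝 0) := by
    have h : Tendsto (fun T : ℝ => Real.exp (-|T|)) atTop (𝓝 0) :=
      Real.tendsto_exp_neg_atTop_nhds_zero.comp tendsto_abs_atTop_atTop
    simpa using (h.const_mul C).mul_const |b - a|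
  -- The sign σ = ±1 treats both vertical sides of the rectangle at once; each integral is at most C
  -- e^(-|T|) |b - a|.
  have hside : ∀ σ : ℝ, |σ| = 1 →
      Tendsto (fun T : ℝ => ∫ y : ℝ in a..b, f ((σ * T : ℝ) + y * I)) atTop (𝓝 0) := by
    intro σ hσ
    refine squeeze_zero_norm (fun T => ?_) hexp
    refine intervalIntegral.norm_integral_le_of_norm_le_const fun y hy => ?_
    rw [Set.uIoc_of_le hab] at hy
    have := hC ((σ * T : ℝ) + y * I) (by simpa using ⟨hy.1.le, hy.2⟩)
    have hre : (((σ * T : ℝ) : ℂ) + y * I).re = σ * T := by simp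
    rwa [hre, abs_mul, hσ, one_mul] at this
  have hlim : ∀ c ∈ Set.Icc a b, Tendsto (fun T : ℝ => ∫ t : ℝ in (-T)..T, f (t + c * I)) atTop
      (𝓝 (∫ t : ℝ, f (t + c * I))) := fun c hc =>
    intervalIntegral_tendsto_integral (hI c hc) tendsto_neg_atTop_atBot tendsto_id
  have hzero : ∀ T : ℝ, (∫ t : ℝ in (-T)..T, f (t + a * I)) - (∫ t : ℝ in (-T)..T, f (t + b * I)) +
      I • (∫ y : ℝ in a..b, f ((1 * T : ℝ) + y * I)) -
      I • (∫ y : ℝ in a..b, f ((-1 * T : ℝ) + y * I)) = 0 := by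
    intro T
    have := integral_boundary_rect_eq_zero_of_differentiableOn f ⟨-T, a⟩ ⟨T, b⟩
      (hd.mono fun z hz => by simpa [Set.uIcc_of_le hab] using hz.2)
    simpa using this
  have key := (((hlim a ⟨le_rfl, hab⟩).sub (hlim b ⟨hab, le_rfl⟩)).add
    ((hside 1 (by simp)).const_smul I)).sub ((hside (-1) (by simp)).const_smul I)
  have h0 := tendsto_nhds_unique (key.congr hzero) tendsto_const_nhds
  simpa [sub_eq_zero] using h0

theorem norm_pow_le_factorial_mul_exp (z : ℂ) (n : ℕ) :
    ‖z ^ n‖ ≤ n.factorial * Real.exp ‖z‖ := by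
  have := Real.pow_div_factorial_le_exp ‖z‖ (norm_nonneg z) n
  rw [div_le_iff₀ (by positivity)] at this
  rw [norm_pow]; linarith

theorem exists_norm_eval_le_mul_exp (p : Polynomial ℂ) :
    ∃ C, 0 ≤ C ∧ ∀ z, ‖p.eval z‖ ≤ C * Real.exp ‖z‖ := by
  induction p using Polynomial.induction_on' with
  | add p q hp hq =>
    obtain ⟨C, hC, h⟩ := hp
    obtain ⟨D, hD, h'⟩ := hq
    refine ⟨C + D, by positivity, fun z => ?_⟩
    rw [Polynomial.eval_add, add_mul]
    exact (norm_add_le _ _).trans (add_le_add (h z) (h' z))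
  | monomial n a =>
    refine ⟨‖a‖ * n.factorial, by positivity, fun z => ?_⟩
    rw [Polynomial.eval_monomial, norm_mul, mul_assoc]
    gcongr
    exact norm_pow_le_factorial_mul_exp z n

/-! ### Bounds for sech and the kernel z / sinh(πz) -/

theorem sech_nonneg (x : ℝ) : 0 ≤ sech x := by unfold sech; positivity

theorem sech_le_one (x : ℝ) : sech x ≤ 1 := by
  unfold sech
  rw [div_le_one (Real.cosh_pos x)]
  exact Real.one_le_cosh x

@[fun_prop]
theorem continuous_sech : Continuous sech :=
  continuous_const.div Real.continuous_cosh fun x => (Real.cosh_pos x).ne'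

theorem sech_pi_mul_le (t : ℝ) : sech (Real.pi * t) ≤ 2 * Real.exp (-(2 * |t|)) := by
  unfold sech
  have h1 : Real.exp (2 * |t|) ≤ Real.exp |Real.pi * t| := by
    rw [abs_mul, abs_of_pos Real.pi_pos]
    have := Real.pi_gt_three
    gcongr
    linarith
  have h2 : Real.exp |Real.pi * t| ≤ 2 * Real.cosh (Real.pi * t) := by
    rw [← Real.cosh_abs, Real.cosh_eq]
    have := Real.exp_pos (-|Real.pi * t|)
    linarith
  rw [Real.exp_neg, ← div_eq_mul_inv, div_le_div_iff₀ (Real.cosh_pos _) (Real.exp_pos _)]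
  linarith

open Complex in
/-- The function `z / sinh (π z)`, extended by continuity to `z = 0`. -/
noncomputable def divSinhPi (z : ℂ) : ℂ := (dslope (fun z => sinh (Real.pi * z)) 0 z)⁻¹

theorem divSinhPi_of_ne {z : ℂ} (hz : z ≠ 0) : divSinhPi z = z / Complex.sinh (Real.pi * z) := by
  rw [divSinhPi, dslope_of_ne _ hz, slope_def_field]
  simp

theorem norm_sinh_ge_sinh_abs_re (z : ℂ) : Real.sinh |z.re| ≤ ‖Complex.sinh z‖ := by
  have h1 : |Real.exp z.re - Real.exp (-z.re)| ≤ ‖Complex.exp z - Complex.exp (-z)‖ := by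
    have := abs_norm_sub_norm_le (Complex.exp z) (Complex.exp (-z))
    simpa [Complex.norm_exp] using this
  rw [← Real.abs_sinh, Real.sinh_eq, Complex.sinh, abs_div, norm_div]
  simpa using div_le_div_of_nonneg_right h1 zero_le_two

/-- The zeros of sinh(πz) are the points of iℤ, read off from those of the sine, and 0 is the only
one in the strip. -/
theorem sinh_pi_mul_ne_zero {z : ℂ} (hz : z ≠ 0) (him : |z.im| < 1) :
    Complex.sinh (Real.pi * z) ≠ 0 := by
  intro h
  have h1 : Complex.sin (Real.pi * z * Complex.I) = 0 := by rw [Complex.sin_mul_I, h, zero_mul]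
  obtain ⟨k, hk⟩ := Complex.sin_eq_zero_iff.1 h1
  have hpi : (Real.pi : ℂ) ≠ 0 := by exact_mod_cast Real.pi_ne_zero
  have h2 : z * Complex.I = k := mul_left_cancel₀ hpi (by linear_combination hk)
  have hre := congrArg Complex.re h2
  have him' := congrArg Complex.im h2
  simp at hre him'
  rw [← abs_neg, hre] at him
  have hk0 : k = 0 := by
    rw [← Int.abs_lt_one_iff]; exact_mod_cast him
  refine hz (Complex.ext him' ?_)
  simp [hk0] at hre
  simpa using hre

theorem differentiableOn_divSinhPi : DifferentiableOn ℂ divSinhPi {z | |z.im| < 1} := by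
  have hd : DifferentiableOn ℂ (fun z : ℂ => Complex.sinh (Real.pi * z)) Set.univ := by fun_prop
  have h := (Complex.differentiableOn_dslope (c := 0) Filter.univ_mem).2 hd
  refine (h.mono (Set.subset_univ _)).inv fun z hz => ?_
  by_cases h0 : z = 0
  · subst h0
    have : HasDerivAt (fun z : ℂ => Complex.sinh (Real.pi * z)) Real.pi 0 := by
      simpa using ((hasDerivAt_id (0 : ℂ)).const_mul (Real.pi : ℂ)).csinh
    rw [dslope_same, this.deriv]
    exact_mod_cast Real.pi_ne_zero
  · rw [dslope_of_ne _ h0, slope_def_field]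
    simpa using ⟨sinh_pi_mul_ne_zero h0 hz, h0⟩

/-- Since π > 3 there is a spare factor e^s ≥ 1 + s ≥ 2, which absorbs the term e^(-πs) ≤ 1. -/
theorem exp_two_mul_le_sinh_pi_mul {s : ℝ} (hs : 1 ≤ s) :
    Real.exp (2 * s) ≤ 2 * Real.sinh (Real.pi * s) := by
  have h1 : Real.exp (3 * s) ≤ Real.exp (Real.pi * s) := by
    have := Real.pi_gt_three
    gcongr
  have h2 : Real.exp (-(Real.pi * s)) ≤ 1 := by
    rw [Real.exp_le_one_iff]
    have := Real.pi_pos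
    nlinarith
  have h3 : Real.exp (3 * s) = Real.exp (2 * s) * Real.exp s := by rw [← Real.exp_add]; ring_nf
  have h4 : 1 + s ≤ Real.exp s := by linarith [Real.add_one_le_exp s]
  have h5 : 1 ≤ Real.exp (2 * s) := Real.one_le_exp (by linarith)
  rw [Real.sinh_eq]
  nlinarith

-- For |Re z| ≤ 1 compactness suffices. Beyond that, the numerator grows at most like e^|Re z| while
-- sinh(πz) is at least e^(2|Re z|)/2, leaving the decay e^(-|Re z|).
open Complex in
theorem exists_norm_eval_mul_divSinhPi_pow_le (q : Polynomial ℂ) {m : ℕ} (hm : m ≠ 0) :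
    ∃ C, ∀ z : ℂ, z.im ∈ Set.Icc (-(1 / 2) : ℝ) (1 / 2) →
      ‖q.eval z * divSinhPi z ^ m‖ ≤ C * Real.exp (-|z.re|) := by
  obtain ⟨C, hC, hq⟩ := exists_norm_eval_le_mul_exp (q * Polynomial.X ^ m)
  have hK : IsCompact (Set.Icc (-1 : ℝ) 1 ×ℂ Set.Icc (-(1 / 2) : ℝ) (1 / 2)) :=
    isCompact_Icc.reProdIm isCompact_Icc
  have hcont : ContinuousOn (fun z : ℂ => q.eval z * divSinhPi z ^ m)
      (Set.Icc (-1 : ℝ) 1 ×ℂ Set.Icc (-(1 / 2) : ℝ) (1 / 2)) := by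
    refine q.continuous.continuousOn.mul (ContinuousOn.pow ?_ m)
    refine differentiableOn_divSinhPi.continuousOn.mono fun z hz => ?_
    have := abs_le.2 hz.2
    exact lt_of_le_of_lt this (by norm_num)
  obtain ⟨M, hM⟩ := hK.exists_bound_of_continuousOn hcont
  refine ⟨max (M * Real.exp 1) (C * Real.exp (1 / 2) * 2), fun z hz => ?_⟩
  rcases le_or_gt |z.re| 1 with h | h
  · have hMz := hM z ⟨abs_le.1 h, hz⟩
    have hM0 : 0 ≤ M := (norm_nonneg _).trans hMz
    calc _ ≤ M := hMz
      _ ≤ M * Real.exp (1 - |z.re|) :=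
        le_mul_of_one_le_right hM0 (Real.one_le_exp (by linarith))
      _ = M * Real.exp 1 * Real.exp (-|z.re|) := by rw [mul_assoc, ← Real.exp_add]; ring_nf
      _ ≤ _ := by gcongr; exact le_max_left _ _
  · have hz0 : z ≠ 0 := by rintro rfl; simp at h; linarith
    have hs := exp_two_mul_le_sinh_pi_mul h.le
    have hsn : Real.sinh (Real.pi * |z.re|) ≤ ‖sinh (Real.pi * z)‖ := by
      have := norm_sinh_ge_sinh_abs_re (Real.pi * z)
      simpa [abs_mul, abs_of_pos Real.pi_pos] using this
    have h2 : 2 ≤ Real.exp (2 * |z.re|) := by linarith [Real.add_one_le_exp (2 * |z.re|)]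
    -- The lower bound for the base is at least 1, so a positive power only increases it.
    have hpow : Real.exp (2 * |z.re|) / 2 ≤ ‖sinh (Real.pi * z)‖ ^ m := by
      refine le_trans ?_ (le_self_pow₀ (by linarith) hm)
      linarith
    have hnz : ‖z‖ ≤ |z.re| + 1 / 2 := (Complex.norm_le_abs_re_add_abs_im z).trans
      (by gcongr; exact abs_le.2 hz)
    have heq : q.eval z * divSinhPi z ^ m =
        (q * Polynomial.X ^ m).eval z / sinh (Real.pi * z) ^ m := by
      rw [divSinhPi_of_ne hz0]
      simp [div_pow, mul_div_assoc]
    rw [heq, norm_div, norm_pow]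
    calc _ ≤ C * Real.exp (|z.re| + 1 / 2) / (Real.exp (2 * |z.re|) / 2) := by
          gcongr
          exact (hq z).trans (by gcongr)
      _ = C * Real.exp (1 / 2) * 2 * Real.exp (-|z.re|) := by
          rw [Real.exp_add, show 2 * |z.re| = |z.re| + |z.re| by ring, Real.exp_add, Real.exp_neg]
          field_simp
      _ ≤ _ := by gcongr; exact le_max_right _ _

open Complex in
theorem inv_sinh_pi_mul_add_half_I (t : ℝ) {σ : ℂ} (hσ : σ = 1 ∨ σ = -1) :
    (sinh (Real.pi * (t + σ / 2 * I)))⁻¹ = -σ * I * sech (Real.pi * t) := by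
  have h : sinh (Real.pi * (t + σ / 2 * I)) = σ * I * cosh ((Real.pi * t : ℝ) : ℂ) := by
    have e : (Real.pi : ℂ) * (t + σ / 2 * I) = (Real.pi * t : ℝ) + σ * (Real.pi / 2) * I := by
      push_cast; ring
    rw [e, sinh_add, cosh_mul_I, sinh_mul_I]
    rcases hσ with rfl | rfl <;> simp [mul_comm]
  have hs : σ * σ = 1 := by rcases hσ with rfl | rfl <;> simp
  have hc : cosh ((Real.pi * t : ℝ) : ℂ) ≠ 0 := by
    rw [← ofReal_cosh]; exact_mod_cast (Real.cosh_pos _).ne'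
  rw [h]
  refine inv_eq_of_mul_eq_one_right ?_
  have : ((sech (Real.pi * t) : ℝ) : ℂ) = 1 / cosh ((Real.pi * t : ℝ) : ℂ) := by
    rw [sech]; push_cast; rfl
  rw [this]
  field_simp
  linear_combination (-I ^ 2) * hs - I_sq

-- Both sides are integrals of q(z) (z / sinh(πz))^m, along Im z = -1/2 and Im z = 1/2.
open Complex in
theorem integral_eval_mul_sech_pow (q : Polynomial ℂ) {m : ℕ} (hm : m ≠ 0) :
    ∫ t : ℝ, (Polynomial.X ^ m * q).eval (t - 1 / 2 * I) * (I * sech (Real.pi * t)) ^ m =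
      ∫ t : ℝ, (Polynomial.X ^ m * q).eval (t + 1 / 2 * I) * (-I * sech (Real.pi * t)) ^ m := by
  obtain ⟨C, hC⟩ := exists_norm_eval_mul_divSinhPi_pow_le q hm
  have key := integral_horizontal_line_eq (by norm_num) (DifferentiableOn.mul
    q.differentiable.differentiableOn ((differentiableOn_divSinhPi.mono fun z hz =>
      lt_of_le_of_lt (abs_le.2 hz) (by norm_num)).pow m)) hC
  have hval : ∀ (t : ℝ) (σ : ℂ), σ = 1 ∨ σ = -1 → ∀ w : ℂ, w = t + σ / 2 * I →
      q.eval w * divSinhPi w ^ m =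
        (Polynomial.X ^ m * q).eval w * (-σ * I * sech (Real.pi * t)) ^ m := by
    rintro t σ hσ w rfl
    have hne : (t : ℂ) + σ / 2 * I ≠ 0 := by
      intro h
      have := congrArg im h
      rcases hσ with rfl | rfl <;> simp at this
    rw [divSinhPi_of_ne hne, div_eq_mul_inv _ (sinh _), inv_sinh_pi_mul_add_half_I t hσ]
    simp only [Polynomial.eval_mul, Polynomial.eval_pow, Polynomial.eval_X]
    rw [mul_pow (_ + _)]
    ring
  calc _ = ∫ t : ℝ, q.eval (t + (-(1 / 2) : ℝ) * I) * divSinhPi (t + (-(1 / 2) : ℝ) * I) ^ m := by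
        refine integral_congr_ae (.of_forall fun t => ?_)
        have := hval t (-1) (Or.inr rfl) (t - 1 / 2 * I) (by ring)
        simp only [neg_neg, one_mul] at this
        simp only
        rw [← this]
        push_cast
        ring_nf
    _ = ∫ t : ℝ, q.eval (t + (1 / 2 : ℝ) * I) * divSinhPi (t + (1 / 2 : ℝ) * I) ^ m := key
    _ = _ := by
        refine integral_congr_ae (.of_forall fun t => ?_)
        have := hval t 1 (Or.inl rfl) (t + 1 / 2 * I) (by ring)
        simp only [neg_mul, one_mul] at this
        simp only [neg_mul]
        rw [← this]
        push_cast
        ring_nf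


/-! ### Moment identities for the two laws -/

theorem sechDensity_nonneg (t : ℝ) : 0 ≤ sechDensity t := sech_nonneg _

theorem logisticDensity_nonneg (t : ℝ) : 0 ≤ logisticDensity t := by
  have := Real.pi_pos
  unfold logisticDensity; positivity

theorem continuous_sechDensity : Continuous sechDensity := by unfold sechDensity; fun_prop

theorem continuous_logisticDensity : Continuous logisticDensity := by
  unfold logisticDensity; fun_prop

theorem logisticDensity_le (t : ℝ) : logisticDensity t ≤ Real.pi / 2 * sechDensity t := by
  have h0 := sech_nonneg (Real.pi * t)
  have h1 := sech_le_one (Real.pi * t)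
  unfold logisticDensity sechDensity
  have := Real.pi_pos
  gcongr
  nlinarith

theorem integral_withDensity_ofReal {g : ℝ → ℝ} (hg : Continuous g) (h0 : ∀ t, 0 ≤ g t)
    (F : ℝ → ℂ) :
    ∫ t, F t ∂(volume : Measure ℝ).withDensity (fun t => ENNReal.ofReal (g t)) =
      ∫ t, (g t : ℂ) * F t := by
  rw [integral_withDensity_eq_integral_toReal_smul (by fun_prop) (by simp)]
  simp [ENNReal.toReal_ofReal, h0]

theorem integrable_exp_abs_withDensity {g : ℝ → ℝ} (hg : Continuous g) (h0 : ∀ t, 0 ≤ g t) {C : ℝ}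
    (hC : ∀ t, g t ≤ C * Real.exp (-(2 * |t|))) :
    Integrable (fun t : ℝ => Real.exp |t|)
      ((volume : Measure ℝ).withDensity fun t => ENNReal.ofReal (g t)) := by
  rw [integrable_withDensity_iff_integrable_smul' (by fun_prop) (by simp)]
  simp only [ENNReal.toReal_ofReal, h0, smul_eq_mul]
  refine (integrable_exp_neg_abs.const_mul C).mono' (by fun_prop) (.of_forall fun t => ?_)
  rw [Real.norm_of_nonneg (mul_nonneg (h0 t) (Real.exp_pos _).le)]
  calc _ ≤ C * Real.exp (-(2 * |t|)) * Real.exp |t| := by gcongr; exact hC t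
    _ = _ := by rw [mul_assoc, ← Real.exp_add]; ring_nf

theorem integrable_exp_abs_sechLaw : Integrable (fun t : ℝ => Real.exp |t|) sechLaw :=
  integrable_exp_abs_withDensity continuous_sechDensity sechDensity_nonneg sech_pi_mul_le

theorem integrable_exp_abs_logisticLaw : Integrable (fun t : ℝ => Real.exp |t|) logisticLaw :=
  integrable_exp_abs_withDensity (C := Real.pi / 2 * 2) continuous_logisticDensity
    logisticDensity_nonneg fun t => (logisticDensity_le t).trans <| by
      have := Real.pi_pos
      rw [mul_assoc]
      gcongr
      exact sech_pi_mul_le t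

theorem integrable_eval_of_integrable_exp_abs {ν : Measure ℝ}
    (hν : Integrable (fun t : ℝ => Real.exp |t|) ν) (p : Polynomial ℂ) (c : ℂ) :
    Integrable (fun t : ℝ => p.eval (t + c)) ν := by
  obtain ⟨C, hC, h⟩ := exists_norm_eval_le_mul_exp p
  refine (hν.const_mul (C * Real.exp ‖c‖)).mono'
    (p.continuous.comp (by fun_prop)).aestronglyMeasurable (.of_forall fun t => ?_)
  refine (h _).trans ?_
  rw [mul_assoc, ← Real.exp_add]
  gcongr
  refine (norm_add_le _ _).trans ?_
  simp [add_comm]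

-- The boundary values for m = 1 have opposite signs, so the part X · `p.divX` cancels in the sum
-- and only the constant term contributes.
open Complex in
theorem integral_eval_add_eval_sechLaw (p : Polynomial ℂ) :
    ∫ t : ℝ, (p.eval (t + -(1 / 2 * I)) + p.eval (t + 1 / 2 * I)) ∂sechLaw = 2 * p.eval 0 := by
  have hi := integrable_eval_of_integrable_exp_abs integrable_exp_abs_sechLaw
  have h := integral_eval_mul_sech_pow p.divX one_ne_zero
  have hX : ∫ t : ℝ, (Polynomial.X * p.divX).eval (t + -(1 / 2 * I)) ∂sechLaw =
      - ∫ t : ℝ, (Polynomial.X * p.divX).eval (t + 1 / 2 * I) ∂sechLaw := by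
    unfold sechLaw
    simp only [integral_withDensity_ofReal continuous_sechDensity sechDensity_nonneg]
    refine mul_left_cancel₀ I_ne_zero ?_
    rw [mul_neg, ← neg_mul I, ← integral_const_mul, ← integral_const_mul]
    simp only [pow_one] at h
    refine (integral_congr_ae (.of_forall fun t => ?_)).trans (h.trans
      (integral_congr_ae (.of_forall fun t => ?_))) <;>
    · simp only [sechDensity, sub_eq_add_neg]; ring
  have hp : ∀ z, p.eval z = (Polynomial.X * p.divX).eval z + p.eval 0 := by
    intro z
    conv_lhs => rw [← Polynomial.divX_mul_X_add p]
    simp [Polynomial.coeff_zero_eq_eval_zero, mul_comm]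
  have hadd : ∀ t : ℝ, p.eval (t + -(1 / 2 * I)) + p.eval (t + 1 / 2 * I) =
      (Polynomial.X * p.divX).eval (t + -(1 / 2 * I)) +
      (Polynomial.X * p.divX).eval (t + 1 / 2 * I) + 2 * p.eval 0 := by
    intro t
    rw [hp (_ + _), hp (t + 1 / 2 * I)]
    ring
  have hint : Integrable (fun t : ℝ => (Polynomial.X * p.divX).eval (t + -(1 / 2 * I)) +
      (Polynomial.X * p.divX).eval (t + 1 / 2 * I)) sechLaw := (hi _ _).add (hi _ _)
  simp_rw [hadd]
  rw [integral_add hint (integrable_const _), integral_add (hi _ _) (hi _ _), hX]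
  simp

-- For m = 2 the boundary values agree, so the part divisible by X² cancels in the difference. The
-- linear Taylor part contributes its increment from t + i/2 to t - i/2.
open Complex in
theorem integral_eval_sub_eval_logisticLaw (p : Polynomial ℂ) :
    ∫ t : ℝ, (p.eval (t + -(1 / 2 * I)) - p.eval (t + 1 / 2 * I)) ∂logisticLaw =
      -I * p.derivative.eval 0 := by
  have hi := integrable_eval_of_integrable_exp_abs integrable_exp_abs_logisticLaw
  have h := integral_eval_mul_sech_pow p.divX.divX two_ne_zero
  have hX : ∫ t : ℝ, (Polynomial.X ^ 2 * p.divX.divX).eval (t + -(1 / 2 * I)) ∂logisticLaw =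
      ∫ t : ℝ, (Polynomial.X ^ 2 * p.divX.divX).eval (t + 1 / 2 * I) ∂logisticLaw := by
    unfold logisticLaw
    simp only [integral_withDensity_ofReal continuous_logisticDensity logisticDensity_nonneg]
    -- The sign undoes (±i)² = -1; π/2 normalises the density.
    have h' := congrArg (fun z : ℂ => -(Real.pi / 2 : ℂ) * z) h
    simp only [← integral_const_mul] at h'
    refine (integral_congr_ae (.of_forall fun t => ?_)).trans (h'.trans
      (integral_congr_ae (.of_forall fun t => ?_))) <;>
    · simp only [logisticDensity, sub_eq_add_neg, mul_pow, neg_sq, I_sq]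
      push_cast
      ring
  have hp : ∀ z, p.eval z = (Polynomial.X ^ 2 * p.divX.divX).eval z +
      (p.derivative.eval 0 * z + p.eval 0) := by
    intro z
    conv_lhs => rw [← Polynomial.divX_mul_X_add p, ← Polynomial.divX_mul_X_add p.divX]
    simp only [Polynomial.eval_add, Polynomial.eval_mul, Polynomial.eval_X, Polynomial.eval_C,
      Polynomial.eval_pow, Polynomial.coeff_divX, ← Polynomial.coeff_zero_eq_eval_zero,
      Polynomial.coeff_derivative]
    simp
    ring
  have hsub : ∀ t : ℝ, p.eval (t + -(1 / 2 * I)) - p.eval (t + 1 / 2 * I) =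
      (Polynomial.X ^ 2 * p.divX.divX).eval (t + -(1 / 2 * I)) -
      (Polynomial.X ^ 2 * p.divX.divX).eval (t + 1 / 2 * I) + -I * p.derivative.eval 0 := by
    intro t
    rw [hp (_ + _), hp (t + 1 / 2 * I)]
    ring
  have hint : Integrable (fun t : ℝ => (Polynomial.X ^ 2 * p.divX.divX).eval (t + -(1 / 2 * I)) -
      (Polynomial.X ^ 2 * p.divX.divX).eval (t + 1 / 2 * I)) logisticLaw := (hi _ _).sub (hi _ _)
  simp_rw [hsub]
  rw [integral_add hint (integrable_const _), integral_sub (hi _ _) (hi _ _), hX]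
  simp

/-! ### From random variables to iterated integrals -/

theorem integrable_and_integral_comp_of_indepFun {Ω : Type*} [MeasurableSpace Ω] {μ : Measure Ω}
    [IsProbabilityMeasure μ] {L U : Ω → ℝ} {lam ν : Measure ℝ} (hL : HasLaw L lam μ)
    (hU : HasLaw U ν μ) (hexp : Integrable (fun t : ℝ => Real.exp |t|) lam)
    (hν : ∀ᵐ u ∂ν, |u| ≤ 1) (hind : IndepFun L U μ) (n : ℕ) (x : ℂ) :
    Integrable (fun ω => (x + Complex.I * (L ω : ℂ) - 1 / 2 + (U ω : ℂ)) ^ n) μ ∧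
      ∫ ω, (x + Complex.I * (L ω : ℂ) - 1 / 2 + (U ω : ℂ)) ^ n ∂μ =
        ∫ t : ℝ, ∫ u : ℝ, (x + Complex.I * (t : ℂ) - 1 / 2 + (u : ℂ)) ^ n ∂ν ∂lam := by
  have : IsProbabilityMeasure lam :=
    hL.map_eq ▸ Measure.isProbabilityMeasure_map hL.aemeasurable
  have : IsProbabilityMeasure ν :=
    hU.map_eq ▸ Measure.isProbabilityMeasure_map hU.aemeasurable
  have hUω : ∀ᵐ ω ∂μ, |U ω| ≤ 1 := by
    rw [← hU.map_eq] at hν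
    exact ae_of_ae_map hU.aemeasurable hν
  have hLω : Integrable (fun ω => Real.exp |L ω|) μ := by
    rw [← hL.map_eq] at hexp
    exact hexp.comp_aemeasurable hL.aemeasurable
  have hLm := hL.aemeasurable
  have hUm := hU.aemeasurable
  have hint : Integrable (fun ω => (x + Complex.I * (L ω : ℂ) - 1 / 2 + (U ω : ℂ)) ^ n) μ := by
    -- 3/2 bounds the shift 1/2 plus |U| ≤ 1.
    refine (hLω.const_mul (n.factorial * Real.exp (‖x‖ + 3 / 2))).mono'
      (by fun_prop) ?_
    filter_upwards [hUω] with ω hω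
    refine (norm_pow_le_factorial_mul_exp _ n).trans ?_
    rw [mul_assoc, ← Real.exp_add]
    gcongr
    refine (norm_add_le _ _).trans ?_
    refine (add_le_add_left (norm_sub_le _ _) _).trans ?_
    refine (add_le_add_left (add_le_add_left (norm_add_le _ _) _) _).trans ?_
    simp
    linarith
  refine ⟨hint, ?_⟩
  have hprod := hind.hasLaw_prod hL hU
  have hcont : Continuous fun y : ℝ × ℝ =>
      (x + Complex.I * (y.1 : ℂ) - 1 / 2 + (y.2 : ℂ)) ^ n := by fun_prop
  have hint' : Integrable (fun y : ℝ × ℝ =>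
      (x + Complex.I * (y.1 : ℂ) - 1 / 2 + (y.2 : ℂ)) ^ n) (lam.prod ν) := by
    rw [← hprod.map_eq, integrable_map_measure hcont.aestronglyMeasurable hprod.aemeasurable]
    exact hint
  rw [← integral_prod _ hint']
  exact hprod.integral_comp hcont.aestronglyMeasurable

/-- The two atoms already have total mass 1, so the law is carried by {0, 1}. -/
theorem hasLaw_fair_coin {Ω : Type*} [MeasurableSpace Ω] {μ : Measure Ω} [IsProbabilityMeasure μ]
    {U : Ω → ℝ} (hU : AEMeasurable U μ) (h0 : μ {ω | U ω = 0} = 1 / 2)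
    (h1 : μ {ω | U ω = 1} = 1 / 2) :
    HasLaw U ((2⁻¹ : ENNReal) • Measure.dirac 0 + (2⁻¹ : ENNReal) • Measure.dirac 1) μ := by
  refine ⟨hU, ?_⟩
  have := Measure.isProbabilityMeasure_map hU
  have hm : ∀ a : ℝ, μ.map U {a} = μ {ω | U ω = a} := fun a =>
    Measure.map_apply_of_aemeasurable hU (measurableSet_singleton a)
  have hdisj : Disjoint ({0} : Set ℝ) {1} := by simp
  have hone : μ.map U ({0} ∪ {1}) = 1 := by
    rw [measure_union hdisj (measurableSet_singleton _), hm, hm, h0, h1]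
    exact ENNReal.add_halves 1
  have hae : ∀ᵐ u ∂μ.map U, u ∈ ({0} ∪ {1} : Set ℝ) :=
    (prob_compl_eq_zero_iff (by measurability)).2 hone
  rw [← Measure.restrict_eq_self_of_ae_mem hae,
    Measure.restrict_union hdisj (measurableSet_singleton _), Measure.restrict_singleton,
    Measure.restrict_singleton, hm, hm, h0, h1, one_div]

theorem hasLaw_of_isUniform_Icc {Ω : Type*} [MeasurableSpace Ω] {μ : Measure Ω}
    [IsProbabilityMeasure μ] {U : Ω → ℝ} (hU : pdf.IsUniform U (Set.Icc 0 1) μ volume) :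
    HasLaw U (volume.restrict (Set.Icc 0 1)) μ := by
  refine ⟨hU.aemeasurable (by simp) (by simp), ?_⟩
  rw [hU, ProbabilityTheory.cond]
  simp

theorem integral_Icc_pow (w : ℂ) (n : ℕ) :
    ∫ u : ℝ in Set.Icc 0 1, (w - 1 / 2 + (u : ℂ)) ^ n =
      ((w + 1 / 2) ^ (n + 1) - (w - 1 / 2) ^ (n + 1)) / (n + 1) := by
  have hn : (n : ℂ) + 1 ≠ 0 := by exact_mod_cast n.succ_ne_zero
  have hd : ∀ u : ℝ, HasDerivAt (fun u : ℝ => (w - 1 / 2 + (u : ℂ)) ^ (n + 1) / (n + 1))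
      ((w - 1 / 2 + (u : ℂ)) ^ n) u := by
    intro u
    have h := ((((hasDerivAt_id u).ofReal_comp).const_add (w - 1 / 2)).pow (n + 1)).div_const
      ((n : ℂ) + 1)
    convert! h using 1
    simp
    field_simp
  rw [integral_Icc_eq_integral_Ioc, ← intervalIntegral.integral_of_le zero_le_one,
    intervalIntegral.integral_eq_sub_of_hasDerivAt (fun u _ => hd u)
      (Continuous.intervalIntegrable (by fun_prop) _ _)]
  push_cast
  ring

theorem mainTheorem12 {Ω : Type*} [MeasurableSpace Ω] (μ : Measure Ω) [IsProbabilityMeasure μ] :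
    (∀ L U : Ω → ℝ, HasLaw L logisticLaw μ → pdf.IsUniform U (Set.Icc 0 1) μ volume →
      IndepFun L U μ → ∀ (n : ℕ) (x : ℂ),
        Integrable (fun ω => (x + Complex.I * (L ω : ℂ) - 1 / 2 + (U ω : ℂ)) ^ n) μ ∧
        ∫ ω, (x + Complex.I * (L ω : ℂ) - 1 / 2 + (U ω : ℂ)) ^ n ∂μ = x ^ n) ∧
    (∀ L U : Ω → ℝ, HasLaw L sechLaw μ → AEMeasurable U μ →
      μ {ω | U ω = 0} = 1 / 2 → μ {ω | U ω = 1} = 1 / 2 →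
      IndepFun L U μ → ∀ (n : ℕ) (x : ℂ),
        Integrable (fun ω => (x + Complex.I * (L ω : ℂ) - 1 / 2 + (U ω : ℂ)) ^ n) μ ∧
        ∫ ω, (x + Complex.I * (L ω : ℂ) - 1 / 2 + (U ω : ℂ)) ^ n ∂μ = x ^ n) := by
  refine ⟨fun L U hL hU hind n x => ?_, fun L U hL hUm h0 h1 hind n x => ?_⟩
  · obtain ⟨hint, heq⟩ := integrable_and_integral_comp_of_indepFun hL (hasLaw_of_isUniform_Icc hU)
      integrable_exp_abs_logisticLaw ((ae_restrict_iff' measurableSet_Icc).2 (.of_forall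
        fun u hu => abs_le.2 ⟨by linarith [hu.1], hu.2⟩)) hind n x
    refine ⟨hint, heq.trans ?_⟩
    -- As i(t ∓ i/2) = it ± 1/2, this polynomial takes the endpoint values of the antiderivative in
    -- u; its derivative at 0 is (n+1) i x^n, and the factor -i removes i.
    have h := integral_eval_sub_eval_logisticLaw
      ((Polynomial.C x + Polynomial.C Complex.I * Polynomial.X) ^ (n + 1))
    have hn : (n : ℂ) + 1 ≠ 0 := by exact_mod_cast n.succ_ne_zero
    simp_rw [integral_Icc_pow, integral_div]
    rw [div_eq_iff hn]
    convert h using 1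
    · refine integral_congr_ae (.of_forall fun t => ?_)
      simp only [Polynomial.eval_pow, Polynomial.eval_add, Polynomial.eval_mul, Polynomial.eval_C,
        Polynomial.eval_X]
      congr 2
      · linear_combination (1 / 2 : ℂ) * Complex.I_sq
      · linear_combination (-1 / 2 : ℂ) * Complex.I_sq
    · rw [Polynomial.derivative_pow]
      simp
      linear_combination ((n + 1) * x ^ n) * Complex.I_sq
  · obtain ⟨hint, heq⟩ := integrable_and_integral_comp_of_indepFun hL (hasLaw_fair_coin hUm h0 h1)
      integrable_exp_abs_sechLaw (by
        rw [ae_add_measure_iff]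
        constructor <;> refine Measure.ae_smul_measure ?_ _ <;> simp [ae_dirac_eq]) hind n x
    refine ⟨hint, heq.trans ?_⟩
    have h := integral_eval_add_eval_sechLaw
      ((Polynomial.C x + Polynomial.C Complex.I * Polynomial.X) ^ n)
    have hinner : ∀ t : ℝ, ∫ u : ℝ, (x + Complex.I * (t : ℂ) - 1 / 2 + (u : ℂ)) ^ n
        ∂((2⁻¹ : ENNReal) • Measure.dirac (0 : ℝ) + (2⁻¹ : ENNReal) • Measure.dirac 1) =
        2⁻¹ * (((x + Complex.I * (t : ℂ) + 1 / 2) ^ n + (x + Complex.I * (t : ℂ) - 1 / 2) ^ n)) := by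
      intro t
      rw [integral_add_measure ((integrable_dirac (by simp)).smul_measure (by simp))
        ((integrable_dirac (by simp)).smul_measure (by simp)), integral_smul_measure,
        integral_smul_measure, integral_dirac, integral_dirac]
      simp
      ring
    simp_rw [hinner]
    rw [integral_const_mul, inv_mul_eq_iff_eq_mul₀ two_ne_zero]
    convert h using 1
    · refine integral_congr_ae (.of_forall fun t => ?_)
      simp only [Polynomial.eval_pow, Polynomial.eval_add, Polynomial.eval_mul, Polynomial.eval_C,
        Polynomial.eval_X]
      congr 2
      · linear_combination (1 / 2 : ℂ) * Complex.I_sq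
      · linear_combination (-1 / 2 : ℂ) * Complex.I_sq
    · simp
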